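/- Let $D$ be a diagram of an oriented virtual link: a generic immersion of finitely many disjoint oriented circles into the plane (regular closed curves with finitely many transverse double points and no other singularities), in which each double point is declared to be either classical, with a choice of the over-strand, or virtual. The covering graph $\tilde D$ has the classical crossings as vertices and the long arcs as edges, i.e. the oriented arcs of the circles that run from one classical crossing to the next and may pass virtual crossings in between; a circle without classical crossings is a closed edge without vertices. Write $C^0(\tilde D,\mathbb Z)$ and $C^1(\tilde D,\mathbb Z)$ for the integral functions on the vertices and on the edges, and let $\delta f(e)=f(\text{end of }e)-f(\text{start of }e)$, and $\delta f(e)=0$ if $e$ is a closed edge. Draw each crossing so that both strands go upwards. The virtual index cocycle $vi_D\in C^1(\tilde D,\mathbb Z)$ assigns to an edge the sum of the signs of the virtual crossings that it passes, where a passage has sign $+1$ if it goes from the bottom left to the top right and $-1$ if it goes from the bottom right to the top left; so a virtual crossing that the edge passes twice contributes both signs. The virtual index class $\iota_D\in H^1(\tilde D,\mathbb Z)$ is the class of $vi_D$. For a classical crossing $c$ let $\beta^l(c)\in C^1(\tilde D,\mathbb Z)$ have the label $-1$ at the bottom left end and $+1$ at the top left end at $c$, and let $\beta^r(c)$ have the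 label $+1$ at the bottom right end and $-1$ at the top right end; the value on an edge is the sum of the labels at its ends at $c$, regardless of which strand goes over. Put $ci^l_D=\sum_c\beta^l(c)$ and $ci^r_D=\sum_c\beta^r(c)$, the sums being over all classical crossings. Theorem. For every such $D$ the two cochains coincide, $ci^l_D=ci^r_D=:ci_D$, and the canonical index cocycle $ci_D$ is cohomologous to $vi_D$: there is $f\in C^0(\tilde D,\mathbb Z)$ with $ci_D-vi_D=\delta f$. In other words, $ci_D$ represents the virtual index class, $[ci_D]=\iota_D$ in $H^1(\tilde D,\mathbb Z)$. -/

import Mathlib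

/-- A generic immersion of `n` disjoint oriented circles into the plane `ℂ`: regular closed
`C¹`-curves whose only singularities are finitely many transverse double points.  Each circle is
`ℝ/ℤ`, oriented by the positive direction of `ℝ`. -/
structure GenericImmersion where
  /-- the number of components -/
  n : ℕ
  /-- the immersed circles; `(i, x)` is the point `x` of the `i`-th circle -/
  pos : Fin n × UnitAddCircle → ℂ
  contDiff : ∀ i, ContDiff ℝ 1 (fun t : ℝ => pos (i, (t : UnitAddCircle)))
  immersion : ∀ i x, deriv (fun t : ℝ => pos (i, x + (t : UnitAddCircle))) 0 ≠ 0
  finite_double : {p | ∃ q, q ≠ p ∧ pos q = pos p}.Finite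
  no_triple : ∀ p q r, pos p = pos q → pos q = pos r → p = q ∨ q = r ∨ p = r
  transverse : ∀ i x j y, (i, x) ≠ (j, y) → pos (i, x) = pos (j, y) →
    LinearIndependent ℝ ![deriv (fun t : ℝ => pos (i, x + (t : UnitAddCircle))) 0,
      deriv (fun t : ℝ => pos (j, y + (t : UnitAddCircle))) 0]

namespace GenericImmersion

/-- The points of the parametrizing circles. -/
abbrev Point (D : GenericImmersion) : Type := Fin D.n × UnitAddCircle

/-- The velocity vector at a point of the parametrizing circles. -/
noncomputable def vel (D : GenericImmersion) (p : D.Point) : ℂ :=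
  deriv (fun t : ℝ => D.pos (p.1, p.2 + (t : UnitAddCircle))) 0

/-- The passages: those points that are mapped to double points.  There are two over each. -/
def passages (D : GenericImmersion) : Set D.Point := {p | ∃ q, q ≠ p ∧ D.pos q = D.pos p}

/-- The crossings: the double points in the plane. -/
def crossings (D : GenericImmersion) : Set ℂ := D.pos '' D.passages

theorem passages_finite (D : GenericImmersion) : D.passages.Finite := D.finite_double

theorem crossings_finite (D : GenericImmersion) : D.crossings.Finite :=
  D.passages_finite.image _

open Classical in
/-- The other passage through the same crossing (`p` itself if `p` is not a passage). -/
noncomputable def other (D : GenericImmersion) (p : D.Point) : D.Point :=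
  if h : ∃ q, q ≠ p ∧ D.pos q = D.pos p then h.choose else p

theorem other_eq (D : GenericImmersion) {p q : D.Point} (hne : q ≠ p)
    (hq : D.pos q = D.pos p) : D.other p = q := by
  have h : ∃ q, q ≠ p ∧ D.pos q = D.pos p := ⟨q, hne, hq⟩
  have hs := h.choose_spec
  rw [other, dif_pos h]
  rcases D.no_triple h.choose p q hs.2 hq.symm with h1 | h1 | h1
  · exact absurd h1 hs.1
  · exact absurd h1.symm hne
  · exact h1

/-- The sign of the strand at the passage `p`, that is, the local intersection number of the
strand through `p` with the other strand of the crossing.  If the crossing is drawn so that both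
strands go upwards, the sign is `1` for the strand that goes from the bottom left to the top right,
and `-1` for the strand that goes from the bottom right to the top left. -/
noncomputable def strandSign (D : GenericImmersion) (p : D.Point) : ℤ :=
  ((SignType.sign ((D.vel p).re * (D.vel (D.other p)).im
    - (D.vel p).im * (D.vel (D.other p)).re) : SignType) : ℤ)

end GenericImmersion

/-- A diagram of an oriented virtual link: a generic immersion of oriented circles into the plane,
a choice of the crossings that are classical, and at each of these a choice of the strand that
goes over.  The other crossings are virtual. -/
structure VirtualLinkDiagram extends GenericImmersion where
  /-- the classical crossings -/
  classical : Set ℂ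
  classical_subset : classical ⊆ toGenericImmersion.crossings
  /-- the passage through a classical crossing that goes over -/
  overPassage : classical → Fin n × UnitAddCircle
  pos_overPassage : ∀ c : classical, pos (overPassage c) = c

namespace VirtualLinkDiagram

/-- The points of the parametrizing circles. -/
abbrev Point (D : VirtualLinkDiagram) : Type := D.toGenericImmersion.Point

/-- The vertices of the covering graph: the classical crossings. -/
abbrev Vertex (D : VirtualLinkDiagram) : Type := D.classical

noncomputable instance (D : VirtualLinkDiagram) : Fintype D.Vertex :=
  (D.crossings_finite.subset D.classical_subset).fintype

/-- A long arc that runs from a classical crossing to a classical crossing and contains no classical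
crossing in between.  (Its two ends may be the same passage; then its length is `1`.) -/
structure LongArc (D : VirtualLinkDiagram) where
  /-- the component that contains the arc -/
  comp : Fin D.n
  /-- the parameter of the initial point -/
  start : UnitAddCircle
  /-- the length of the arc in the parametrizing circle `ℝ/ℤ` -/
  length : ℝ
  length_pos : 0 < length
  length_le : length ≤ 1
  start_mem : D.pos (comp, start) ∈ D.classical
  stop_mem : D.pos (comp, start + (length : UnitAddCircle)) ∈ D.classical
  interior_notMem : ∀ t : ℝ, 0 < t → t < length →
    D.pos (comp, start + (t : UnitAddCircle)) ∉ D.classical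

namespace LongArc

variable {D : VirtualLinkDiagram}

/-- The passage at which the long arc starts. -/
def initial (e : D.LongArc) : D.Point := (e.comp, e.start)

/-- The passage at which the long arc ends. -/
noncomputable def terminal (e : D.LongArc) : D.Point :=
  (e.comp, e.start + (e.length : UnitAddCircle))

/-- The vertex at which the long arc starts. -/
def source (e : D.LongArc) : D.Vertex := ⟨D.pos e.initial, e.start_mem⟩

/-- The vertex at which the long arc ends. -/
noncomputable def target (e : D.LongArc) : D.Vertex := ⟨D.pos e.terminal, e.stop_mem⟩

end LongArc

/-- The components without classical crossings; they are closed long arcs, and circles without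
vertices in the covering graph. -/
abbrev FreeCircle (D : VirtualLinkDiagram) : Type :=
  {i : Fin D.n // ∀ x : UnitAddCircle, D.pos (i, x) ∉ D.classical}

/-- The edges of the covering graph: the long arcs, including the closed ones. -/
abbrev Edge (D : VirtualLinkDiagram) : Type := D.LongArc ⊕ D.FreeCircle

/-- The interior points of an edge. -/
def edgeInterior (D : VirtualLinkDiagram) : D.Edge → Set D.Point
  | Sum.inl e => (fun t : ℝ => (e.comp, e.start + (t : UnitAddCircle))) '' Set.Ioo 0 e.length
  | Sum.inr i => {p | p.1 = i.1}

/-- The passages through virtual crossings. -/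
def virtualPassages (D : VirtualLinkDiagram) : Set D.Point :=
  {p | p ∈ D.passages ∧ D.pos p ∉ D.classical}

theorem virtualPassages_inter_finite (D : VirtualLinkDiagram) (e : D.Edge) :
    (D.virtualPassages ∩ D.edgeInterior e).Finite :=
  D.passages_finite.subset fun _ hp => hp.1.1

/-- Integral `0`-cochains of the covering graph. -/
abbrev Cochain0 (D : VirtualLinkDiagram) : Type := D.Vertex → ℤ

/-- Integral `1`-cochains of the covering graph; all of them are cocycles. -/
abbrev Cochain1 (D : VirtualLinkDiagram) : Type := D.Edge → ℤ

/-- The coboundary operator of the covering graph.  It vanishes on circles without vertices, as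
on any loop. -/
noncomputable def coboundary (D : VirtualLinkDiagram) : D.Cochain0 →+ D.Cochain1 where
  toFun f := Sum.elim (fun e => f e.target - f e.source) (fun _ => 0)
  map_zero' := by
    funext e
    cases e <;> simp
  map_add' f g := by
    funext e
    cases e
    · simp only [Sum.elim_inl, Pi.add_apply]
      ring
    · simp

/-- The first integral cohomology group of the covering graph. -/
abbrev H1 (D : VirtualLinkDiagram) : Type := D.Cochain1 ⧸ D.coboundary.range

/-- The cohomology class of a `1`-cochain. -/
noncomputable def cohomologyClass (D : VirtualLinkDiagram) (a : D.Cochain1) : D.H1 := QuotientAddGroup.mk a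

/-- Two `1`-cochains are cohomologous if they differ by the coboundary of a `0`-cochain. -/
def Cohomologous (D : VirtualLinkDiagram) (a b : D.Cochain1) : Prop :=
  ∃ f : D.Cochain0, a - b = D.coboundary f

/-- The virtual index cocycle: its value on a long arc is the sum of the signs of the virtual
crossings that the arc passes. -/
noncomputable def virtualIndexCocycle (D : VirtualLinkDiagram) : D.Cochain1 := fun e =>
  ∑ p ∈ (D.virtualPassages_inter_finite e).toFinset, D.strandSign p

/-- The virtual index class. -/
noncomputable def virtualIndexClass (D : VirtualLinkDiagram) : D.H1 :=
  D.cohomologyClass D.virtualIndexCocycle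

open Classical in
/-- The left cochain of a classical crossing `c`.  Draw `c` so that both strands go upwards: the
label is `-1` on the incoming edge on the left (the bottom left one, whose strand has sign `1`), `1`
on the outgoing edge on the left (the top left one, whose strand has sign `-1`), and `0` elsewhere.
The labels are added up on a loop that approaches `c` with both ends. -/
noncomputable def leftCochain (D : VirtualLinkDiagram) (c : D.Vertex) : D.Cochain1 :=
  Sum.elim
    (fun e => (if e.target = c ∧ D.strandSign e.terminal = 1 then -1 else 0)
      + (if e.source = c ∧ D.strandSign e.initial = -1 then 1 else 0))
    (fun _ => 0)

open Classical in
/-- The right cochain of a classical crossing `c`: the label is `1` on the incoming edge on the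
right (the bottom right one, whose strand has sign `-1`), `-1` on the outgoing edge on the right
(the top right one, whose strand has sign `1`), and `0` elsewhere. -/
noncomputable def rightCochain (D : VirtualLinkDiagram) (c : D.Vertex) : D.Cochain1 :=
  Sum.elim
    (fun e => (if e.target = c ∧ D.strandSign e.terminal = -1 then 1 else 0)
      + (if e.source = c ∧ D.strandSign e.initial = 1 then -1 else 0))
    (fun _ => 0)

/-- The left canonical index cocycle. -/
noncomputable def leftCanonicalCocycle (D : VirtualLinkDiagram) : D.Cochain1 :=
  ∑ c : D.Vertex, D.leftCochain c

/-- The right canonical index cocycle. -/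
noncomputable def rightCanonicalCocycle (D : VirtualLinkDiagram) : D.Cochain1 :=
  ∑ c : D.Vertex, D.rightCochain c

end VirtualLinkDiagram

/-!
Replace rays by lines: the direction of the line from `z` to the moving point of an immersed closed
curve extends continuously, by the tangent direction, over the moments when the curve runs through
`z`. So twice the winding number around `z` makes sense for every `z` in the plane, also on the
curve. A point that crosses the curve transversally sees it drop by the intersection sign when it
reaches the curve, and once more when it leaves it: the quotient of the direction by the one for the
round circle that is tangent to the curve at the crossing is continuous there, so both functions
have the same jumps, and for a circle the values are `2`, `1`, `0` inside, on and outside of it.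

Add up over all components and follow a long arc. The crossings in its interior contribute twice
their signs and the two ends once, which gives `2 * (ci - vi)`; so half of this function, restricted
to the classical crossings, has coboundary `ci - vi`. Around a component without classical crossings
the total change is zero, hence so is `vi`.
-/

open Complex Filter Topology Set

section Degree

theorem exists_circleDegree (u : C(UnitAddCircle, Circle)) :
    ∃ n : ℤ, ∃ θ : ℝ → ℝ, Continuous θ ∧ (∀ t : ℝ, Circle.exp (θ t) = u t) ∧
      θ 1 = θ 0 + n * (2 * Real.pi) := by
  obtain ⟨x, hx⟩ := Circle.exp_surjective (u 0)
  obtain ⟨θ, ⟨-, hθ⟩, -⟩ := Circle.isCoveringMap_exp.existsUnique_continuousMap_lifts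
    (⟨fun t : ℝ => u t, by fun_prop⟩ : C(ℝ, Circle)) (a₀ := 0) (e₀ := x) (by simpa using hx)
  have hexp : ∀ t : ℝ, Circle.exp (θ t) = u t := congrFun hθ
  obtain ⟨n, hn⟩ := Circle.exp_eq_exp.1 (show Circle.exp (θ 1) = Circle.exp (θ 0) by
    rw [hexp, hexp, AddCircle.coe_period, QuotientAddGroup.mk_zero])
  exact ⟨n, θ, θ.continuous, hexp, hn⟩

/-- The degree of a continuous map from `ℝ/ℤ` to the unit circle: the number of full turns made by
a continuous choice of its argument along the unit interval. -/
noncomputable def circleDegree (u : C(UnitAddCircle, Circle)) : ℤ := (exists_circleDegree u).choose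

theorem exists_lift_circleDegree (u : C(UnitAddCircle, Circle)) :
    ∃ θ : ℝ → ℝ, Continuous θ ∧ (∀ t : ℝ, Circle.exp (θ t) = u t) ∧
      θ 1 = θ 0 + circleDegree u * (2 * Real.pi) :=
  (exists_circleDegree u).choose_spec

theorem circleDegree_eq_of_lift {u : C(UnitAddCircle, Circle)} {θ : ℝ → ℝ} {n : ℤ}
    (hθ : Continuous θ) (hexp : ∀ t : ℝ, Circle.exp (θ t) = u t)
    (hn : θ 1 = θ 0 + n * (2 * Real.pi)) : circleDegree u = n := by
  obtain ⟨θ', hθ', hexp', hn'⟩ := exists_lift_circleDegree u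
  obtain ⟨m, hm⟩ := Circle.exp_eq_exp.1 ((hexp' 0).trans (hexp 0).symm)
  have hlift : θ' = fun t => θ t + m * (2 * Real.pi) :=
    Circle.isCoveringMap_exp.eq_of_comp_eq hθ' (by fun_prop) (funext fun t => by
      simp only [Function.comp_apply, hexp', Circle.exp_add, hexp, Circle.exp_int_mul_two_pi,
        mul_one]) 0 hm
  have h : (circleDegree u : ℝ) * (2 * Real.pi) = n * (2 * Real.pi) := by
    linarith [congrFun hlift 1]
  exact_mod_cast mul_right_cancel₀ Real.two_pi_pos.ne' h

theorem circleDegree_mul (u v : C(UnitAddCircle, Circle)) :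
    circleDegree (u * v) = circleDegree u + circleDegree v := by
  obtain ⟨θ, hθ, hu, hθ1⟩ := exists_lift_circleDegree u
  obtain ⟨η, hη, hv, hη1⟩ := exists_lift_circleDegree v
  refine circleDegree_eq_of_lift (θ := fun t => θ t + η t) (hθ.add hη) (fun t => ?_) ?_
  · rw [Circle.exp_add, hu, hv, ContinuousMap.mul_apply]
  · rw [hθ1, hη1, Int.cast_add]
    ring

theorem circleDegree_div (u v : C(UnitAddCircle, Circle)) :
    circleDegree (u / v) = circleDegree u - circleDegree v := by
  rw [eq_sub_iff_add_eq, ← circleDegree_mul, div_mul_cancel]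

theorem circleDegree_toCircle_zpow (n : ℤ) :
    circleDegree (⟨AddCircle.toCircle, AddCircle.continuous_toCircle⟩ ^ n) = n := by
  refine circleDegree_eq_of_lift (θ := fun t => n * (2 * Real.pi * t)) (by fun_prop)
    (fun t => ?_) (by simp only [mul_one, mul_zero, zero_add])
  have ht : AddCircle.toCircle (t : UnitAddCircle) = Circle.exp (2 * Real.pi * t) := by
    rw [AddCircle.toCircle_apply_mk, div_one]
  rw [Circle.exp_intCast_mul, ContinuousMap.zpow_apply, ← ht]
  rfl

theorem circleDegree_eq_zero_of_forall_ne {u : C(UnitAddCircle, Circle)} {c : Circle}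
    (h : ∀ x, u x ≠ c) : circleDegree u = 0 := by
  have hslit : ∀ x, ((u x / -c : Circle) : ℂ) ∈ slitPlane := fun x => by
    refine mem_slitPlane_iff_arg.2 ⟨fun harg => h x ?_, Circle.coe_ne_zero _⟩
    have hneg : u x / -c = -1 := by
      rw [← Circle.exp_arg (u x / -c), harg]
      exact Circle.ext exp_pi_mul_I
    rw [← div_mul_cancel (u x) (-c), hneg, neg_mul_neg, one_mul]
  refine circleDegree_eq_of_lift (θ := fun t : ℝ => arg (u t / -c : Circle) + arg (-c : Circle))
    ?_ (fun t => ?_) ?_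
  · refine Continuous.add (continuous_iff_continuousAt.2 fun t => ?_) continuous_const
    exact ContinuousAt.comp' (g := arg) (continuousAt_arg (hslit t)) (by fun_prop)
  · rw [Circle.exp_add, Circle.exp_arg, Circle.exp_arg, div_mul_cancel]
  · simp only [AddCircle.coe_period, QuotientAddGroup.mk_zero, Int.cast_zero, zero_mul, add_zero]

theorem circleDegree_eq_of_forall_ne_mul_zpow {u : C(UnitAddCircle, Circle)} {c : Circle} {n : ℤ}
    (h : ∀ x, u x ≠ c * AddCircle.toCircle x ^ n) : circleDegree u = n := by
  set e : C(UnitAddCircle, Circle) := ⟨AddCircle.toCircle, AddCircle.continuous_toCircle⟩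
  have hzero : circleDegree (u / e ^ n) = 0 := circleDegree_eq_zero_of_forall_ne (c := c)
    fun x hx => h x (div_eq_iff_eq_mul.1 hx)
  rwa [circleDegree_div, circleDegree_toCircle_zpow, sub_eq_zero] at hzero

theorem eventually_circleDegree_eq {S : Type*} [TopologicalSpace S] {s₀ : S}
    {U : S → C(UnitAddCircle, Circle)}
    (hU : ∀ x, ContinuousAt (fun p : S × UnitAddCircle => U p.1 p.2) (s₀, x)) :
    ∀ᶠ s in 𝓝 s₀, circleDegree (U s) = circleDegree (U s₀) := by
  have hne : ∀ᶠ s in 𝓝 s₀, ∀ x ∈ (univ : Set UnitAddCircle), (U s / U s₀) x ≠ -1 := by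
    refine isCompact_univ.eventually_forall_of_forall_eventually fun x _ => ?_
    have hcont : ContinuousAt (fun p : S × UnitAddCircle => U p.1 p.2 / U s₀ p.2) (s₀, x) :=
      (hU x).div' (by fun_prop)
    refine hcont.eventually_ne ?_
    rw [div_self']
    exact (Circle.neg_ne_self 1).symm
  filter_upwards [hne] with s hs
  rw [← sub_eq_zero, ← circleDegree_div]
  exact circleDegree_eq_zero_of_forall_ne fun x => hs x (mem_univ x)

end Degree

section Axis

/-- The direction of the line `ℝ v` in the plane: twice the argument of `v`. Unlike the argument
itself, it does not see the orientation of `v`. -/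
noncomputable def axis (v : ℂ) : Circle := Circle.exp (2 * arg v)

theorem coe_axis {v : ℂ} (hv : v ≠ 0) : (axis v : ℂ) = v / (starRingEnd ℂ) v := by
  have hunit : exp (arg v * I) = v / ‖v‖ := by
    rw [eq_div_iff (by exact_mod_cast norm_ne_zero_iff.2 hv), mul_comm, norm_mul_exp_arg_mul_I]
  calc (axis v : ℂ) = exp (arg v * I) ^ 2 := by
        rw [axis, Circle.coe_exp, ← exp_nat_mul]
        push_cast
        ring_nf
    _ = v / (starRingEnd ℂ) v := by
        rw [hunit, div_pow, ← mul_conj', sq, mul_div_mul_left _ _ hv]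

theorem axis_mul {v w : ℂ} (hv : v ≠ 0) (hw : w ≠ 0) : axis (v * w) = axis v * axis w := by
  ext
  rw [Circle.coe_mul, coe_axis (mul_ne_zero hv hw), coe_axis hv, coe_axis hw, map_mul,
    mul_div_mul_comm]

theorem axis_div {v w : ℂ} (hv : v ≠ 0) (hw : w ≠ 0) : axis (v / w) = axis v / axis w := by
  rw [eq_div_iff_mul_eq', ← axis_mul (div_ne_zero hv hw) hw, div_mul_cancel₀ v hw]

theorem axis_ofReal {r : ℝ} (hr : r ≠ 0) : axis r = 1 := by
  ext
  rw [coe_axis (ofReal_ne_zero.2 hr), conj_ofReal, div_self (ofReal_ne_zero.2 hr), Circle.coe_one]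

theorem axis_coe_circle (ζ : Circle) : axis ζ = ζ ^ 2 := by
  ext
  rw [coe_axis ζ.coe_ne_zero, ← Circle.coe_inv_eq_conj, Circle.coe_inv, div_inv_eq_mul,
    Circle.coe_pow, sq]

theorem axis_I : axis I = -1 := by
  ext
  rw [coe_axis I_ne_zero, conj_I, div_neg, div_self I_ne_zero, Circle.coe_neg, Circle.coe_one]

theorem axis_coe_circle_sub {ζ ξ : Circle} (h : ζ ≠ ξ) : axis (ζ - ξ) = -(ζ * ξ) := by
  have hsub : (ζ - ξ : ℂ) ≠ 0 := sub_ne_zero.2 (Circle.coe_injective.ne h)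
  ext
  rw [coe_axis hsub, div_eq_iff ((map_ne_zero _).2 hsub), map_sub, ← Circle.coe_inv_eq_conj,
    ← Circle.coe_inv_eq_conj]
  push_cast
  field_simp [ζ.coe_ne_zero, ξ.coe_ne_zero]
  ring

theorem continuousAt_axis {v : ℂ} (hv : v ≠ 0) : ContinuousAt axis v := by
  refine IsEmbedding.subtypeVal.continuousAt_iff.2 ?_
  refine ContinuousAt.congr (f := fun z : ℂ => z / (starRingEnd ℂ) z) ?_
    ((eventually_ne_nhds hv).mono fun z hz => (coe_axis hz).symm)
  exact continuousAt_id.div continuous_conj.continuousAt ((map_ne_zero _).2 hv)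

theorem axis_ne_neg_one_of_re_pos {v : ℂ} (hv : 0 < v.re) : axis v ≠ -1 := by
  have hv0 : v ≠ 0 := fun h0 => hv.ne' (by rw [h0, zero_re])
  intro h
  have h' := congrArg ((↑) : Circle → ℂ) h
  rw [coe_axis hv0, Circle.coe_neg, Circle.coe_one, div_eq_iff ((map_ne_zero _).2 hv0)] at h'
  have hre := congrArg re h'
  simp only [neg_mul, one_mul, neg_re, conj_re] at hre
  linarith

theorem axis_sub_ne_neg_axis {v w : ℂ} (h : ‖w‖ < ‖v‖) : axis (v - w) ≠ -axis v := by
  have hv : v ≠ 0 := norm_pos_iff.1 ((norm_nonneg w).trans_lt h)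
  have hre : 0 < (1 - w / v).re := by
    rw [sub_re, one_re, sub_pos]
    exact (re_le_norm _).trans_lt (by rwa [norm_div, div_lt_one (norm_pos_iff.2 hv)])
  have hne : 1 - w / v ≠ 0 := fun h0 => hre.ne' (by rw [h0, zero_re])
  rw [show v - w = v * (1 - w / v) by rw [mul_sub, mul_one, mul_div_cancel₀ w hv],
    axis_mul hv hne, ← mul_neg_one]
  exact fun h1 => axis_ne_neg_one_of_re_pos hre (mul_left_cancel h1)

theorem tendsto_axis_div_axis {α : Type*} {l : Filter α} {f g : α → ℂ}
    (h : Asymptotics.IsEquivalent l f g) (hg : ∀ᶠ x in l, g x ≠ 0) :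
    Tendsto (fun x => axis (f x) / axis (g x)) l (𝓝 1) := by
  have hquot : Tendsto (f / g) l (𝓝 1) := (Asymptotics.isEquivalent_iff_tendsto_one hg).1 h
  have haxis : Tendsto (fun x => axis ((f / g) x)) l (𝓝 1) := by
    have h1 := (continuousAt_axis one_ne_zero).tendsto.comp hquot
    rwa [← ofReal_one, axis_ofReal one_ne_zero] at h1
  refine haxis.congr' ?_
  filter_upwards [hg, hquot.eventually_ne one_ne_zero] with x hgx hx
  exact axis_div (div_ne_zero_iff.1 hx).1 hgx

end Axis

theorem isEquivalent_sub_of_hasStrictDerivAt {𝕜 E : Type*} [NontriviallyNormedField 𝕜]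
    [NormedAddCommGroup E] [NormedSpace 𝕜 E] {f : 𝕜 → E} {f' : E} {x : 𝕜}
    (hf : HasStrictDerivAt f f' x) (hf' : f' ≠ 0) :
    Asymptotics.IsEquivalent (𝓝 (x, x)) (fun p : 𝕜 × 𝕜 => f p.1 - f p.2)
      (fun p => (p.1 - p.2) • f') := by
  refine hf.isLittleO.trans_isBigO (Asymptotics.IsBigO.of_bound ‖f'‖⁻¹ (Eventually.of_forall ?_))
  intro p
  rw [norm_smul, mul_comm ‖p.1 - p.2‖, inv_mul_cancel_left₀ (norm_ne_zero_iff.2 hf')]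

theorem isOpenQuotientMap_const_add_coe (x : UnitAddCircle) :
    IsOpenQuotientMap (fun t : ℝ => x + (t : UnitAddCircle)) :=
  (Homeomorph.addLeft x).isOpenQuotientMap.comp QuotientAddGroup.isOpenQuotientMap_mk

/-- An oriented closed `C¹`-curve in the plane with nowhere vanishing velocity, parametrized by
`ℝ/ℤ`: one component of a generic immersion, with arbitrary self-intersections. -/
structure ImmersedCircle where
  toFun : UnitAddCircle → ℂ
  contDiff : ContDiff ℝ 1 (fun t : ℝ => toFun t)
  immersion : ∀ x, deriv (fun t : ℝ => toFun (x + (t : UnitAddCircle))) 0 ≠ 0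

namespace ImmersedCircle

instance : CoeFun ImmersedCircle (fun _ => UnitAddCircle → ℂ) := ⟨toFun⟩

variable (β : ImmersedCircle)

/-- The velocity vector at a point of the parametrizing circle. -/
noncomputable def velocity (x : UnitAddCircle) : ℂ :=
  deriv (fun t : ℝ => β (x + (t : UnitAddCircle))) 0

theorem velocity_ne_zero (x : UnitAddCircle) : β.velocity x ≠ 0 := β.immersion x

theorem velocity_coe (t : ℝ) : β.velocity t = deriv (fun r : ℝ => β r) t := by
  rw [velocity, ← add_zero t, ← deriv_comp_const_add]
  simp only [AddCircle.coe_add, add_zero]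

theorem continuous_velocity : Continuous β.velocity := by
  rw [QuotientAddGroup.isOpenQuotientMap_mk.isQuotientMap.continuous_iff]
  exact (β.contDiff.continuous_deriv le_rfl).congr fun t => (β.velocity_coe t).symm

theorem continuous : Continuous β :=
  QuotientAddGroup.isOpenQuotientMap_mk.isQuotientMap.continuous_iff.2 β.contDiff.continuous

theorem hasStrictDerivAt (x : UnitAddCircle) :
    HasStrictDerivAt (fun t : ℝ => β (x + (t : UnitAddCircle))) (β.velocity x) 0 := by
  obtain ⟨r, rfl⟩ := QuotientAddGroup.mk_surjective x
  have h : ContDiff ℝ 1 (fun t : ℝ => β ((r + t : ℝ) : UnitAddCircle)) :=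
    β.contDiff.comp (contDiff_const.add contDiff_id)
  exact h.contDiffAt.hasStrictDerivAt one_ne_zero

open Classical in
/-- The direction of the line from `z` to the point `β y`, and that of the tangent line if
`β y = z`. Since lines have no orientation, this depends continuously on `y` even if `β` passes
through `z`. -/
noncomputable def axisAt (z : ℂ) (y : UnitAddCircle) : Circle :=
  axis (if β y = z then β.velocity y else β y - z)

variable {β}

theorem axisAt_of_eq {z : ℂ} {y : UnitAddCircle} (h : β y = z) :
    β.axisAt z y = axis (β.velocity y) := by
  rw [axisAt, if_pos h]

theorem axisAt_of_ne {z : ℂ} {y : UnitAddCircle} (h : β y ≠ z) :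
    β.axisAt z y = axis (β y - z) := by
  rw [axisAt, if_neg h]

theorem continuousAt_axisAt_of_ne {S : Type*} [TopologicalSpace S] {z : S → ℂ} {s : S}
    {y : UnitAddCircle} (hz : ContinuousAt z s) (h : β y ≠ z s) :
    ContinuousAt (fun p : S × UnitAddCircle => β.axisAt (z p.1) p.2) (s, y) := by
  have hdiff : ContinuousAt (fun p : S × UnitAddCircle => β p.2 - z p.1) (s, y) :=
    (β.continuous.continuousAt.comp continuousAt_snd).sub (hz.comp continuousAt_fst)
  have hne : ∀ᶠ p : S × UnitAddCircle in 𝓝 (s, y), β p.2 - z p.1 ≠ 0 :=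
    hdiff.eventually_ne (sub_ne_zero.2 h)
  refine ContinuousAt.congr (f := fun p => axis (β p.2 - z p.1)) ?_
    (hne.mono fun p hp => (axisAt_of_ne (sub_ne_zero.1 hp)).symm)
  exact ContinuousAt.comp' (continuousAt_axis (sub_ne_zero.2 h)) hdiff

variable (β)

theorem tendsto_axis_chord (x : UnitAddCircle) :
    Tendsto (fun p : ℝ × ℝ => axis (β (x + (p.2 : UnitAddCircle)) - β (x + (p.1 : UnitAddCircle))))
      (𝓝 (0, 0) ⊓ 𝓟 {p | β (x + (p.2 : UnitAddCircle)) ≠ β (x + (p.1 : UnitAddCircle))})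
      (𝓝 (axis (β.velocity x))) := by
  have hequiv := (isEquivalent_sub_of_hasStrictDerivAt (β.hasStrictDerivAt x)
    (β.velocity_ne_zero x)).comp_tendsto (continuous_swap.tendsto ((0 : ℝ), (0 : ℝ)))
  have hsub : ∀ᶠ p : ℝ × ℝ in 𝓝 (0, 0) ⊓ 𝓟 {p | β (x + (p.2 : UnitAddCircle)) ≠
      β (x + (p.1 : UnitAddCircle))}, p.2 - p.1 ≠ 0 := by
    filter_upwards [mem_inf_of_right (mem_principal_self _)] with p hp hne
    exact hp (by rw [sub_eq_zero.1 hne])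
  have hratio := (tendsto_axis_div_axis (hequiv.mono inf_le_left)
    (hsub.mono fun p hp => smul_ne_zero hp (β.velocity_ne_zero x))).mul_const (axis (β.velocity x))
  rw [one_mul] at hratio
  refine hratio.congr' (hsub.mono fun p hp => ?_)
  have htangent : axis ((p.2 - p.1) • β.velocity x) = axis (β.velocity x) := by
    rw [real_smul, axis_mul (ofReal_ne_zero.2 hp) (β.velocity_ne_zero x), axis_ofReal hp, one_mul]
  simp only [Function.comp_apply, Prod.fst_swap, Prod.snd_swap]
  rw [htangent, div_mul_cancel]

theorem continuousAt_axisAt_self (x : UnitAddCircle) :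
    ContinuousAt (fun p : UnitAddCircle × UnitAddCircle => β.axisAt (β p.1) p.2) (x, x) := by
  have hchart := (isOpenQuotientMap_const_add_coe x).prodMap (isOpenQuotientMap_const_add_coe x)
  have hx : Prod.map (fun t : ℝ => x + (t : UnitAddCircle)) (fun t : ℝ => x + (t : UnitAddCircle))
      (0, 0) = (x, x) := by simp
  rw [← hx, ← hchart.continuousAt_comp_iff]
  have hvelocity : ContinuousAt (fun p : ℝ × ℝ => axis (β.velocity (x + (p.2 : UnitAddCircle))))
      (0, 0) := by
    refine ContinuousAt.comp' (continuousAt_axis (β.velocity_ne_zero _)) ?_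
    exact (β.continuous_velocity.comp (by fun_prop)).continuousAt
  have htendsto := Tendsto.if (p := fun p : ℝ × ℝ =>
    β (x + (p.2 : UnitAddCircle)) = β (x + (p.1 : UnitAddCircle)))
    (hvelocity.tendsto.mono_left inf_le_left) (by simpa using β.tendsto_axis_chord x)
  simp only [← apply_ite axis] at htendsto
  simpa [ContinuousAt, Function.comp_def, axisAt] using htendsto

theorem continuous_axisAt (z : ℂ) : Continuous (β.axisAt z) := by
  refine continuous_iff_continuousAt.2 fun y => ?_
  by_cases h : β y = z
  · rw [← h]
    exact (β.continuousAt_axisAt_self y).comp (f := fun y' => (y, y'))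
      (continuousAt_const.prodMk continuousAt_id)
  · exact (continuousAt_axisAt_of_ne (s := ()) continuousAt_const h).comp (f := fun y' => ((), y'))
      (continuousAt_const.prodMk continuousAt_id)

/-- Twice the winding number of `β` around `z` for `z` off `β`, as the degree of the direction of
the line from `z` to the moving point of `β`. For `z` on `β` this is still a well defined integer:
at a simple point it is the sum of the winding numbers on the two sides. -/
noncomputable def doubledWinding (z : ℂ) : ℤ := circleDegree ⟨β.axisAt z, β.continuous_axisAt z⟩

variable {β}

theorem eventually_doubledWinding_eq {S : Type*} [TopologicalSpace S] {z : S → ℂ} {s : S}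
    (h : ∀ y, ContinuousAt (fun p : S × UnitAddCircle => β.axisAt (z p.1) p.2) (s, y)) :
    ∀ᶠ t in 𝓝 s, β.doubledWinding (z t) = β.doubledWinding (z s) :=
  eventually_circleDegree_eq h

end ImmersedCircle

theorem eventually_sign_eq {X : Type*} [TopologicalSpace X] {f : X → ℝ} {s : X}
    (hf : ContinuousAt f s) (h : f s ≠ 0) :
    ∀ᶠ t in 𝓝 s, SignType.sign (f t) = SignType.sign (f s) :=
  ((continuousAt_sign_of_ne_zero h).comp' hf)
    ((isOpen_discrete {SignType.sign (f s)}).mem_nhds rfl)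

theorem eventually_sign_norm_add_smul_sub_norm {E : Type*} [NormedAddCommGroup E]
    [InnerProductSpace ℝ E] {v a : E} (h : inner ℝ v a ≠ 0) :
    ∀ᶠ s : ℝ in 𝓝 0, SignType.sign (‖v + s • a‖ - ‖v‖) =
      SignType.sign s * SignType.sign (inner ℝ v a) := by
  have hv : 0 < ‖v‖ := norm_pos_iff.2 fun h0 => h (by rw [h0, inner_zero_left])
  have hsign : ∀ᶠ s : ℝ in 𝓝 0, SignType.sign (2 * inner ℝ v a + s * ‖a‖ ^ 2) =
      SignType.sign (2 * inner ℝ v a + 0 * ‖a‖ ^ 2) :=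
    eventually_sign_eq (by fun_prop) (by simpa using h)
  filter_upwards [hsign] with s hs
  have hsq : (‖v + s • a‖ - ‖v‖) * (‖v + s • a‖ + ‖v‖) =
      s * (2 * inner ℝ v a + s * ‖a‖ ^ 2) := by
    have h1 := norm_add_sq_real v (s • a)
    rw [inner_smul_right, norm_smul, mul_pow, Real.norm_eq_abs, sq_abs] at h1
    linear_combination h1
  rw [zero_mul, add_zero, sign_mul 2, sign_pos two_pos, one_mul] at hs
  rw [← hs, ← sign_mul, ← hsq, sign_mul, sign_pos (add_pos_of_nonneg_of_pos (norm_nonneg _) hv),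
    mul_one]

theorem hasDerivAt_toCircle_add_coe (x : UnitAddCircle) :
    HasDerivAt (fun t : ℝ => (AddCircle.toCircle (x + (t : UnitAddCircle)) : ℂ))
      (2 * Real.pi * I * AddCircle.toCircle x) 0 := by
  have hexp : HasDerivAt (fun t : ℝ => exp ((2 * Real.pi * t : ℝ) * I)) (2 * Real.pi * I) 0 := by
    have h := (((hasDerivAt_id (0 : ℝ)).const_mul (2 * Real.pi)).ofReal_comp.mul_const I).cexp
    simpa using h
  refine ((hexp.const_mul (AddCircle.toCircle x : ℂ)).congr_deriv
    (mul_comm _ _)).congr_of_eventuallyEq (Eventually.of_forall fun t => ?_)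
  simp only [AddCircle.toCircle_add, Circle.coe_mul, AddCircle.toCircle_apply_mk,
    div_one, Circle.coe_exp]

theorem hasDerivAt_roundCircle (c w : ℂ) (x : UnitAddCircle) :
    HasDerivAt (fun t : ℝ => c + w * AddCircle.toCircle (x + (t : UnitAddCircle)))
      (w * (2 * Real.pi * I * AddCircle.toCircle x)) 0 :=
  ((hasDerivAt_toCircle_add_coe x).const_mul w).const_add c

/-- The circle with centre `c` and radius `‖w‖`, traversed once counterclockwise from `c + w`. -/
noncomputable def roundCircle (c : ℂ) {w : ℂ} (hw : w ≠ 0) : ImmersedCircle where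
  toFun y := c + w * AddCircle.toCircle y
  contDiff := by
    simp only [AddCircle.toCircle_apply_mk, Circle.coe_exp]
    exact contDiff_const.add (contDiff_const.mul
      ((ofRealCLM.contDiff.comp (contDiff_const.mul contDiff_id)).mul contDiff_const).cexp)
  immersion x := by
    rw [(hasDerivAt_roundCircle c w x).deriv]
    exact mul_ne_zero hw (mul_ne_zero two_pi_I_ne_zero (Circle.coe_ne_zero _))

namespace roundCircle

variable {c w : ℂ} {hw : w ≠ 0}

theorem apply (y : UnitAddCircle) : roundCircle c hw y = c + w * AddCircle.toCircle y := rfl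

theorem velocity_eq (y : UnitAddCircle) :
    (roundCircle c hw).velocity y = w * (2 * Real.pi * I * AddCircle.toCircle y) :=
  (hasDerivAt_roundCircle c w y).deriv

theorem apply_ne {x y : UnitAddCircle} (h : y ≠ x) : roundCircle c hw y ≠ roundCircle c hw x :=
  fun heq => h (AddCircle.injective_toCircle one_ne_zero
    (Circle.coe_injective (mul_left_cancel₀ hw (add_left_cancel heq))))

theorem exists_eq_velocity_eq (x : UnitAddCircle) (z : ℂ) {b : ℂ} (hb : b ≠ 0) :
    ∃ (c w : ℂ) (hw : w ≠ 0), roundCircle c hw x = z ∧ (roundCircle c hw).velocity x = b := by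
  have hx : (AddCircle.toCircle x : ℂ) ≠ 0 := Circle.coe_ne_zero _
  have hpi := two_pi_I_ne_zero
  refine ⟨z - b / (2 * Real.pi * I), b / (2 * Real.pi * I * AddCircle.toCircle x),
    div_ne_zero hb (mul_ne_zero hpi hx), ?_, ?_⟩
  · rw [apply]
    field_simp
    ring
  · rw [velocity_eq, div_mul_cancel₀ _ (mul_ne_zero hpi hx)]

theorem doubledWinding_eq_two {z : ℂ} (hz : ‖z - c‖ < ‖w‖) :
    (roundCircle c hw).doubledWinding z = 2 := by
  refine circleDegree_eq_of_forall_ne_mul_zpow (c := -axis w) (n := 2) fun y => ?_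
  set ζ := AddCircle.toCircle y with hζ
  have hz' : ‖z - c‖ < ‖w * ζ‖ := by rwa [norm_mul, Circle.norm_coe, mul_one]
  have hdiff : roundCircle c hw y - z = w * ζ - (z - c) := by rw [apply, hζ]; ring
  have hne : roundCircle c hw y ≠ z := sub_ne_zero.1 (by
    rw [hdiff]; exact sub_ne_zero.2 fun h => hz'.ne (by rw [h]))
  rw [ContinuousMap.coe_mk, ImmersedCircle.axisAt_of_ne hne, hdiff, zpow_ofNat, neg_mul,
    ← axis_coe_circle, ← axis_mul hw ζ.coe_ne_zero]
  exact axis_sub_ne_neg_axis hz'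

theorem doubledWinding_eq_zero {z : ℂ} (hz : ‖w‖ < ‖z - c‖) :
    (roundCircle c hw).doubledWinding z = 0 := by
  refine circleDegree_eq_zero_of_forall_ne (c := -axis (c - z)) fun y => ?_
  have hz' : ‖-(w * AddCircle.toCircle y)‖ < ‖c - z‖ := by
    rwa [norm_neg, norm_mul, Circle.norm_coe, mul_one, norm_sub_rev]
  have hdiff : roundCircle c hw y - z = c - z - -(w * AddCircle.toCircle y) := by rw [apply]; ring
  have hne : roundCircle c hw y ≠ z := sub_ne_zero.1 (by
    rw [hdiff]; exact sub_ne_zero.2 fun h => hz'.ne (by rw [h]))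
  rw [ContinuousMap.coe_mk, ImmersedCircle.axisAt_of_ne hne, hdiff]
  exact axis_sub_ne_neg_axis hz'

theorem axisAt_apply (x y : UnitAddCircle) :
    (roundCircle c hw).axisAt (roundCircle c hw x) y =
      -(axis w * AddCircle.toCircle x * AddCircle.toCircle y) := by
  by_cases h : AddCircle.toCircle y = AddCircle.toCircle x
  · have htwo_pi : (2 * Real.pi : ℂ) = ((2 * Real.pi : ℝ) : ℂ) := by push_cast; rfl
    rw [ImmersedCircle.axisAt_of_eq (by rw [apply, apply, h]), velocity_eq,
      axis_mul hw (mul_ne_zero two_pi_I_ne_zero (Circle.coe_ne_zero _)),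
      axis_mul two_pi_I_ne_zero (Circle.coe_ne_zero _), htwo_pi,
      axis_mul (ofReal_ne_zero.2 Real.two_pi_pos.ne') I_ne_zero, axis_ofReal Real.two_pi_pos.ne',
      axis_I, axis_coe_circle, h, one_mul, neg_one_mul, mul_neg, sq, mul_assoc]
  · have hdiff : roundCircle c hw y - roundCircle c hw x =
        w * (AddCircle.toCircle y - AddCircle.toCircle x) := by
      rw [apply, apply]
      ring
    have hne : (AddCircle.toCircle y - AddCircle.toCircle x : ℂ) ≠ 0 :=
      sub_ne_zero.2 (Circle.coe_injective.ne h)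
    rw [ImmersedCircle.axisAt_of_ne (sub_ne_zero.1 (by rw [hdiff]; exact mul_ne_zero hw hne)),
      hdiff, axis_mul hw hne, axis_coe_circle_sub h, mul_neg, mul_assoc,
      mul_comm (AddCircle.toCircle y)]

theorem doubledWinding_eq_one (x : UnitAddCircle) :
    (roundCircle c hw).doubledWinding (roundCircle c hw x) = 1 := by
  refine circleDegree_eq_of_forall_ne_mul_zpow (c := axis w * AddCircle.toCircle x)
    (n := 1) fun y => ?_
  rw [ContinuousMap.coe_mk, axisAt_apply, zpow_one]
  exact Circle.neg_ne_self _

theorem doubledWinding_eq (z : ℂ) :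
    (roundCircle c hw).doubledWinding z = 1 - SignType.sign (‖z - c‖ - ‖w‖) := by
  rcases lt_trichotomy ‖z - c‖ ‖w‖ with h | h | h
  · rw [doubledWinding_eq_two h, sign_neg (sub_neg.2 h)]
    rfl
  · have hnorm : ‖(z - c) / w‖ = 1 := by rw [norm_div, h, div_self (norm_ne_zero_iff.2 hw)]
    obtain ⟨x, hx⟩ := (AddCircle.homeomorphCircle one_ne_zero).surjective
      ⟨(z - c) / w, mem_sphere_zero_iff_norm.2 hnorm⟩
    have hz : roundCircle c hw x = z := by
      rw [apply, ← AddCircle.homeomorphCircle_apply one_ne_zero, hx, mul_div_cancel₀ _ hw,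
        add_sub_cancel]
    rw [← hz, doubledWinding_eq_one, hz, h, sub_self, sign_zero]
    rfl
  · rw [doubledWinding_eq_zero h, sign_pos (sub_pos.2 h)]
    rfl

theorem eventually_doubledWinding_add_smul (x : UnitAddCircle) {a b : ℂ}
    (hb : (roundCircle c hw).velocity x = b) (h : a.re * b.im - a.im * b.re ≠ 0) :
    ∀ᶠ s : ℝ in 𝓝 0, (roundCircle c hw).doubledWinding (roundCircle c hw x + s • a) =
      1 - SignType.sign s * SignType.sign (a.re * b.im - a.im * b.re) := by
  set v := w * AddCircle.toCircle x
  have hv : ‖v‖ = ‖w‖ := by rw [norm_mul, Circle.norm_coe, mul_one]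
  have hcross : a.re * b.im - a.im * b.re = 2 * Real.pi * inner ℝ v a := by
    have hbv : b = (2 * Real.pi : ℝ) * (I * v) := by
      rw [← hb, velocity_eq]
      push_cast
      ring
    rw [hbv, re_ofReal_mul, im_ofReal_mul, I_mul_re, I_mul_im, Complex.inner, mul_re a,
      conj_re, conj_im]
    ring
  have hinner : inner ℝ v a ≠ 0 := fun h0 => h (by rw [hcross, h0, mul_zero])
  filter_upwards [eventually_sign_norm_add_smul_sub_norm hinner] with s hs
  have hdiff : c + v + s • a - c = v + s • a := by ring
  rw [doubledWinding_eq, apply, hdiff, ← hv, hs, hcross, sign_mul (2 * Real.pi),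
    sign_pos Real.two_pi_pos, one_mul, SignType.coe_mul]

end roundCircle

section Transversality

theorem isEquivalent_of_hasFDerivAt {𝕜 E F : Type*} [NontriviallyNormedField 𝕜]
    [NormedAddCommGroup E] [NormedSpace 𝕜 E] [NormedAddCommGroup F] [NormedSpace 𝕜 F]
    {f g : E → F} {L : E →L[𝕜] F} {x : E} (hL : ∃ C, AntilipschitzWith C L)
    (hf : HasFDerivAt f L x) (hg : HasFDerivAt g L x) (hfx : f x = 0) (hgx : g x = 0) :
    Asymptotics.IsEquivalent (𝓝 x) f g := by
  have hlittle : (f - g) =o[𝓝 x] fun y => y - x := by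
    simpa [hfx, hgx] using! (hf.sub hg).isLittleO
  obtain ⟨C, hC⟩ := hL
  have hbig : (fun y => y - x) =O[𝓝 x] g := by
    simpa [hgx] using (hg.isTheta_sub (hC.isInducing L.continuous)).isBigO_symm
  exact hlittle.trans_isBigO hbig

variable {E : Type*} [NormedAddCommGroup E] [NormedSpace ℝ E] {a b : E} {f g f₀ g₀ : ℝ → E}

/-- The linear map `(s, t) ↦ t b - s a`, the derivative of the difference `f t - g s` of two curves
with velocities `b` and `a`. -/
noncomputable def subVelocity (a b : E) : ℝ × ℝ →L[ℝ] E :=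
  (ContinuousLinearMap.snd ℝ ℝ ℝ).smulRight b - (ContinuousLinearMap.fst ℝ ℝ ℝ).smulRight a

theorem exists_antilipschitzWith_subVelocity (h : LinearIndependent ℝ ![a, b]) :
    ∃ C, AntilipschitzWith C (subVelocity a b) := by
  obtain ⟨C, -, hC⟩ := (subVelocity a b).toLinearMap.exists_antilipschitzWith (by
    refine LinearMap.ker_eq_bot'.2 fun p hp => ?_
    obtain ⟨hs, ht⟩ := LinearIndependent.pair_iff.1 h (-p.1) p.2 (by
      rw [neg_smul, neg_add_eq_sub]
      exact hp)
    exact Prod.ext (neg_eq_zero.1 hs) ht)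
  exact ⟨C, hC⟩

theorem hasFDerivAt_sub_curve (hf : HasDerivAt f b 0) (hg : HasDerivAt g a 0) :
    HasFDerivAt (fun p : ℝ × ℝ => f p.2 - g p.1) (subVelocity a b) (0, 0) := by
  have hf' := hf.hasFDerivAt.comp ((0 : ℝ), (0 : ℝ)) (hasFDerivAt_snd (𝕜 := ℝ))
  have hg' := hg.hasFDerivAt.comp ((0 : ℝ), (0 : ℝ)) (hasFDerivAt_fst (𝕜 := ℝ))
  refine (hf'.sub hg').congr_fderiv ?_
  ext <;> simp [subVelocity]

theorem isEquivalent_sub_curve (h : LinearIndependent ℝ ![a, b])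
    (hf : HasDerivAt f b 0) (hg : HasDerivAt g a 0) (hfg : f 0 = g 0)
    (hf₀ : HasDerivAt f₀ b 0) (hg₀ : HasDerivAt g₀ a 0) (hfg₀ : f₀ 0 = g₀ 0) :
    Asymptotics.IsEquivalent (𝓝 (0, 0)) (fun p : ℝ × ℝ => f p.2 - g p.1)
      (fun p => f₀ p.2 - g₀ p.1) :=
  isEquivalent_of_hasFDerivAt (exists_antilipschitzWith_subVelocity h)
    (hasFDerivAt_sub_curve hf hg) (hasFDerivAt_sub_curve hf₀ hg₀) (sub_eq_zero.2 hfg)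
    (sub_eq_zero.2 hfg₀)

theorem eventually_curve_ne (h : LinearIndependent ℝ ![a, b])
    (hf : HasDerivAt f b 0) (hg : HasDerivAt g a 0) :
    ∀ᶠ p : ℝ × ℝ in 𝓝[≠] (0, 0), f p.2 ≠ g p.1 :=
  ((hasFDerivAt_sub_curve hf hg).eventually_ne (c := 0)
    (exists_antilipschitzWith_subVelocity h)).mono fun _ hp => sub_ne_zero.1 hp

theorem re_mul_im_sub_im_mul_re_ne_zero {a b : ℂ} (h : LinearIndependent ℝ ![a, b]) :
    a.re * b.im - a.im * b.re ≠ 0 := by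
  intro h0
  rw [LinearIndependent.pair_iff] at h
  have him := h b.im (-a.im) (Complex.ext (by simp; linarith) (by simp; ring))
  have hre := h b.re (-a.re) (Complex.ext (by simp; ring) (by simp; linarith))
  have ha : a = 0 := Complex.ext (neg_eq_zero.1 hre.2) (neg_eq_zero.1 him.2)
  exact one_ne_zero (h 1 0 (by simp [ha])).1

end Transversality

namespace ImmersedCircle

variable {β β₀ : ImmersedCircle} {γ γ₀ : ℝ → ℂ} {x : UnitAddCircle} {a : ℂ}

theorem continuousAt_axisAt_div_axisAt (hli : LinearIndependent ℝ ![a, β.velocity x])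
    (hγ : HasDerivAt γ a 0) (hβγ : β x = γ 0) (hvel : β₀.velocity x = β.velocity x)
    (hγ₀ : HasDerivAt γ₀ a 0) (hβγ₀ : β₀ x = γ₀ 0) :
    ContinuousAt (fun p : ℝ × UnitAddCircle => β.axisAt (γ p.1) p.2 / β₀.axisAt (γ₀ p.1) p.2)
      (0, x) := by
  have hchart := IsOpenQuotientMap.id.prodMap (X := ℝ) (isOpenQuotientMap_const_add_coe x)
  have hx : Prod.map id (fun t : ℝ => x + (t : UnitAddCircle)) ((0 : ℝ), (0 : ℝ)) = (0, x) := by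
    simp
  rw [← hx, ← hchart.continuousAt_comp_iff, continuousAt_iff_punctured_nhds]
  have hβ := (β.hasStrictDerivAt x).hasDerivAt
  have hβ₀ := (β₀.hasStrictDerivAt x).hasDerivAt
  rw [hvel] at hβ₀
  have hne := eventually_curve_ne hli hβ hγ
  have hne₀ := eventually_curve_ne hli hβ₀ hγ₀
  have hequiv := isEquivalent_sub_curve hli hβ hγ (by simpa using hβγ) hβ₀ hγ₀ (by simpa using hβγ₀)
  have htendsto := tendsto_axis_div_axis (hequiv.mono nhdsWithin_le_nhds)
    (hne₀.mono fun p hp => sub_ne_zero.2 hp)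
  have hvalue : β.axisAt (γ 0) x / β₀.axisAt (γ₀ 0) x = 1 := by
    rw [axisAt_of_eq hβγ, axisAt_of_eq hβγ₀, hvel, div_self']
  simp only [Function.comp_apply, Prod.map_apply, id, QuotientAddGroup.mk_zero, add_zero, hvalue]
  refine htendsto.congr' ?_
  filter_upwards [hne, hne₀] with p hp hp₀
  simp only [Function.comp_apply, Prod.map, id, axisAt_of_ne hp, axisAt_of_ne hp₀]

theorem eventually_doubledWinding_sub_eq
    (hβγ : ∀ y, ContinuousAt (fun p : ℝ × UnitAddCircle =>
      β.axisAt (γ p.1) p.2 / β₀.axisAt (γ₀ p.1) p.2) (0, y)) :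
    ∀ᶠ s in 𝓝 0, β.doubledWinding (γ s) - β₀.doubledWinding (γ₀ s) =
      β.doubledWinding (γ 0) - β₀.doubledWinding (γ₀ 0) := by
  have h := eventually_circleDegree_eq (U := fun s => ⟨β.axisAt (γ s), β.continuous_axisAt (γ s)⟩ /
    ⟨β₀.axisAt (γ₀ s), β₀.continuous_axisAt (γ₀ s)⟩) hβγ
  simpa only [circleDegree_div] using! h

theorem eventually_doubledWinding_crossing (hli : LinearIndependent ℝ ![a, β.velocity x])
    (hγ : HasDerivAt γ a 0) (hβγ : β x = γ 0)
    (hcont : ∀ y ≠ x, ContinuousAt (fun p : ℝ × UnitAddCircle => β.axisAt (γ p.1) p.2) (0, y)) :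
    ∀ᶠ s in 𝓝 0, β.doubledWinding (γ s) = β.doubledWinding (γ 0) - SignType.sign s *
      SignType.sign (a.re * (β.velocity x).im - a.im * (β.velocity x).re) := by
  obtain ⟨c, w, hw, hx, hvel⟩ :=
    roundCircle.exists_eq_velocity_eq x (γ 0) (β.velocity_ne_zero x)
  set β₀ := roundCircle c hw
  let γ₀ : ℝ → ℂ := fun s => β₀ x + s • a
  have hγ₀ : HasDerivAt γ₀ a 0 :=
    (((hasDerivAt_id (0 : ℝ)).smul_const a).const_add (β₀ x)).congr_deriv (one_smul ℝ a)
  have hγ₀_zero : β₀ x = γ₀ 0 := by simp [γ₀]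
  have hratio : ∀ y, ContinuousAt (fun p : ℝ × UnitAddCircle =>
      β.axisAt (γ p.1) p.2 / β₀.axisAt (γ₀ p.1) p.2) (0, y) := by
    intro y
    rcases eq_or_ne y x with rfl | hy
    · exact continuousAt_axisAt_div_axisAt hli hγ hβγ hvel hγ₀ hγ₀_zero
    · exact (hcont y hy).div' (β₀.continuousAt_axisAt_of_ne hγ₀.continuousAt
        (hγ₀_zero ▸ roundCircle.apply_ne hy))
  filter_upwards [eventually_doubledWinding_sub_eq hratio,
    roundCircle.eventually_doubledWinding_add_smul x hvel
      (re_mul_im_sub_im_mul_re_ne_zero hli)] with s hs hs₀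
  rw [← hγ₀_zero, roundCircle.doubledWinding_eq_one, sub_eq_iff_eq_add] at hs
  rw [hs, hs₀]
  ring

end ImmersedCircle

theorem injOn_prodMk_add_coe {ι : Type*} (i : ι) (x : UnitAddCircle) :
    InjOn (fun t : ℝ => (i, x + (t : UnitAddCircle))) (Ico 0 1) := by
  intro s hs t ht h
  rw [← zero_add (1 : ℝ)] at hs ht
  exact (AddCircle.coe_eq_coe_iff_of_mem_Ico hs ht).1 (add_left_cancel (congrArg Prod.snd h))

theorem finsum_mem_Icc {M : Type*} [AddCommMonoid M] {f : ℝ → M} {a b : ℝ} (hab : a < b)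
    (hfin : (Icc a b ∩ f.support).Finite) :
    ∑ᶠ t ∈ Icc a b, f t = f a + (f b + ∑ᶠ t ∈ Ioo a b, f t) := by
  rw [← Ico_insert_right hab.le, ← Ioo_insert_left hab, insert_comm] at hfin ⊢
  rw [finsum_mem_insert' f (by simp [hab.ne]) (hfin.subset (by gcongr; simp)),
    finsum_mem_insert' f (by simp) (hfin.subset (by gcongr; simp [subset_def]; tauto))]

section Jumps

variable {h σ : ℝ → ℤ} {a b : ℝ}

theorem eventually_sum_sign_sub_eq (F : Finset ℝ) {s : ℝ} (hs : σ s ≠ 0 → s ∈ F) :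
    ∀ᶠ t in 𝓝 s, ∑ r ∈ F, SignType.sign (t - r) * σ r =
      ∑ r ∈ F, SignType.sign (s - r) * σ r + SignType.sign (t - s) * σ s := by
  have hterm (r : ℝ) : ∀ᶠ t in 𝓝 s, SignType.sign (t - r) * σ r =
      SignType.sign (s - r) * σ r + if s = r then SignType.sign (t - r) * σ r else 0 := by
    rcases eq_or_ne s r with rfl | hr
    · simp
    · filter_upwards [eventually_sign_eq (continuousAt_id.sub continuousAt_const)
        (sub_ne_zero.2 hr)] with t ht
      rw [show SignType.sign (t - r) = SignType.sign (s - r) from ht, if_neg hr, add_zero]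
  filter_upwards [(F.eventually_all).2 fun r _ => hterm r] with t ht
  rw [Finset.sum_congr rfl ht, Finset.sum_add_distrib, Finset.sum_ite_eq, ite_eq_left_iff.2]
  intro hsF
  rw [not_imp_comm.1 hs hsF, mul_zero]

theorem add_sum_sign_eq_of_jumps (F : Finset ℝ) (hab : a ≤ b)
    (hF : ∀ t ∈ Icc a b, σ t ≠ 0 → t ∈ F)
    (hjump : ∀ s ∈ Icc a b, ∀ᶠ t in 𝓝 s, h t = h s - SignType.sign (t - s) * σ s) :
    h b + ∑ r ∈ F, SignType.sign (b - r) * σ r = h a + ∑ r ∈ F, SignType.sign (a - r) * σ r := by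
  refine isPreconnected_Icc.constant (f := fun t => h t + ∑ r ∈ F, SignType.sign (t - r) * σ r)
    (fun s hs => ?_) (right_mem_Icc.2 hab) (left_mem_Icc.2 hab)
  refine (tendsto_nhds_of_eventually_eq ?_).mono_left nhdsWithin_le_nhds
  filter_upwards [hjump s hs, eventually_sum_sign_sub_eq F (hF s hs)] with t ht hsum
  rw [ht, hsum]
  ring

theorem sub_eq_of_jumps (hab : a < b) (hfin : (Icc a b ∩ σ.support).Finite)
    (hjump : ∀ s ∈ Icc a b, ∀ᶠ t in 𝓝 s, h t = h s - SignType.sign (t - s) * σ s) :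
    h b - h a = -σ a - σ b - 2 * ∑ᶠ t ∈ Ioo a b, σ t := by
  have key := add_sum_sign_eq_of_jumps hfin.toFinset hab.le
    (fun t ht hσ => hfin.mem_toFinset.2 ⟨ht, hσ⟩) hjump
  have hsum (t : ℝ) : ∑ r ∈ hfin.toFinset, SignType.sign (t - r) * σ r =
      SignType.sign (t - a) * σ a + (SignType.sign (t - b) * σ b +
        ∑ᶠ r ∈ Ioo a b, SignType.sign (t - r) * σ r) := by
    have hsub : (Icc a b ∩ Function.support fun r => SignType.sign (t - r) * σ r) ⊆
      Icc a b ∩ σ.support := by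
      gcongr
      exact Function.support_mul_subset_right _ _
    rw [← finsum_mem_Icc hab (hfin.subset hsub)]
    refine (finsum_mem_eq_sum_of_subset _ (by simpa using hsub) (by simp)).symm
  have ha : ∑ᶠ r ∈ Ioo a b, SignType.sign (a - r) * σ r = -∑ᶠ r ∈ Ioo a b, σ r := by
    simp only [← finsum_neg_distrib]
    exact finsum_mem_congr rfl fun r hr => by
      rw [sign_neg (sub_neg.2 hr.1), SignType.coe_neg_one, neg_one_mul]
  have hb : ∑ᶠ r ∈ Ioo a b, SignType.sign (b - r) * σ r = ∑ᶠ r ∈ Ioo a b, σ r :=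
    finsum_mem_congr rfl fun r hr => by
      rw [sign_pos (sub_pos.2 hr.2), SignType.coe_one, one_mul]
  rw [hsum, hsum, ha, hb, sign_pos (sub_pos.2 hab), sign_neg (sub_neg.2 hab), sub_self, sub_self,
    sign_zero, SignType.coe_zero, SignType.coe_one, SignType.coe_neg_one] at key
  linarith

end Jumps

namespace GenericImmersion

variable (D : GenericImmersion)

theorem strandSign_of_notMem {p : D.Point} (hp : p ∉ D.passages) : D.strandSign p = 0 := by
  rw [strandSign, show D.other p = p from dif_neg hp, mul_comm, sub_self, sign_zero]
  rfl

theorem other_ne_and_pos_other {p : D.Point} (hp : p ∈ D.passages) :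
    D.other p ≠ p ∧ D.pos (D.other p) = D.pos p := by
  obtain ⟨q, hq⟩ := hp
  rwa [D.other_eq hq.1 hq.2]

theorem linearIndependent_vel_other {p : D.Point} (hp : p ∈ D.passages) :
    LinearIndependent ℝ ![D.vel p, D.vel (D.other p)] :=
  have h := D.other_ne_and_pos_other hp
  D.transverse p.1 p.2 (D.other p).1 (D.other p).2 h.1.symm h.2.symm

theorem strandSign_eq_one_or {p : D.Point} (hp : p ∈ D.passages) :
    D.strandSign p = 1 ∨ D.strandSign p = -1 := by
  rw [strandSign]
  rcases (re_mul_im_sub_im_mul_re_ne_zero (D.linearIndependent_vel_other hp)).lt_or_gt with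
    h | h
  · exact Or.inr (by rw [sign_neg h]; rfl)
  · exact Or.inl (by rw [sign_pos h]; rfl)

/-- The `i`-th circle of a generic immersion. -/
def component (i : Fin D.n) : ImmersedCircle where
  toFun x := D.pos (i, x)
  contDiff := D.contDiff i
  immersion := D.immersion i

theorem continuousAt_axisAt_component {p q : D.Point} (h : q = p ∨ D.pos q ≠ D.pos p) :
    ContinuousAt (fun r : ℝ × UnitAddCircle =>
      (D.component q.1).axisAt (D.component p.1 (p.2 + (r.1 : UnitAddCircle))) r.2) (0, q.2) := by
  have hcont : Continuous fun s : ℝ => p.2 + (s : UnitAddCircle) :=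
    (isOpenQuotientMap_const_add_coe p.2).continuous
  have hzero : p.2 + ((0 : ℝ) : UnitAddCircle) = p.2 := add_zero p.2
  rcases h with rfl | h
  · exact ((D.component q.1).continuousAt_axisAt_self q.2).comp_of_eq
      (f := fun r : ℝ × UnitAddCircle => (q.2 + (r.1 : UnitAddCircle), r.2))
      ((hcont.comp continuous_fst).prodMk continuous_snd).continuousAt (Prod.ext hzero rfl)
  · refine (D.component q.1).continuousAt_axisAt_of_ne
      (z := fun s : ℝ => D.component p.1 (p.2 + (s : UnitAddCircle)))
      ((D.component p.1).continuous.comp hcont).continuousAt ?_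
    rw [hzero]
    exact h

theorem eventually_component_doubledWinding_eq (p : D.Point) (j : Fin D.n) :
    ∀ᶠ s : ℝ in 𝓝 0, (D.component j).doubledWinding (D.pos (p.1, p.2 + (s : UnitAddCircle))) =
      (D.component j).doubledWinding (D.pos p) -
        if j = (D.other p).1 then SignType.sign s * D.strandSign p else 0 := by
  have hp0 : D.pos p = D.pos (p.1, p.2 + ((0 : ℝ) : UnitAddCircle)) := by simp
  by_cases hj : p ∈ D.passages ∧ j = (D.other p).1
  · obtain ⟨hp, rfl⟩ := hj
    have hother := D.other_ne_and_pos_other hp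
    have hcont : ∀ y ≠ (D.other p).2, ContinuousAt (fun r : ℝ × UnitAddCircle =>
        (D.component (D.other p).1).axisAt (D.pos (p.1, p.2 + (r.1 : UnitAddCircle))) r.2)
        (0, y) := fun y hy =>
      D.continuousAt_axisAt_component (q := ((D.other p).1, y)) <| or_iff_not_imp_left.2
        fun hne hpos => hy (congrArg Prod.snd (D.other_eq hne hpos)).symm
    filter_upwards [ImmersedCircle.eventually_doubledWinding_crossing
      (β := D.component (D.other p).1) (D.linearIndependent_vel_other hp)
      ((D.component p.1).hasStrictDerivAt p.2).hasDerivAt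
      (hother.2.trans hp0) hcont] with s hs
    rw [if_pos rfl, hp0]
    exact hs
  · have hzero (s : ℝ) :
        (if j = (D.other p).1 then (SignType.sign s : ℤ) * D.strandSign p else 0) = 0 := by
      rw [ite_eq_right_iff]
      exact fun h => by rw [D.strandSign_of_notMem fun hp => hj ⟨hp, h⟩, mul_zero]
    have hcont (y : UnitAddCircle) : ContinuousAt (fun r : ℝ × UnitAddCircle =>
        (D.component j).axisAt (D.pos (p.1, p.2 + (r.1 : UnitAddCircle))) r.2) (0, y) :=
      D.continuousAt_axisAt_component (p := p) (q := (j, y)) <| or_iff_not_imp_left.2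
        fun hne hpos => hj ⟨⟨_, hne, hpos⟩, by rw [D.other_eq hne hpos]⟩
    filter_upwards [(D.component j).eventually_doubledWinding_eq
      (z := fun s : ℝ => D.pos (p.1, p.2 + (s : UnitAddCircle))) hcont] with s hs
    rw [hzero, sub_zero, hp0]
    exact hs

/-- Twice the index of the point `z` with respect to the whole diagram. -/
noncomputable def doubledIndex (z : ℂ) : ℤ := ∑ j, (D.component j).doubledWinding z

theorem eventually_doubledIndex_eq (p : D.Point) :
    ∀ᶠ s : ℝ in 𝓝 0, D.doubledIndex (D.pos (p.1, p.2 + (s : UnitAddCircle))) =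
      D.doubledIndex (D.pos p) - SignType.sign s * D.strandSign p := by
  filter_upwards [eventually_all.2 (D.eventually_component_doubledWinding_eq p)] with s hs
  simp only [doubledIndex, hs, Finset.sum_sub_distrib, Finset.sum_ite_eq', Finset.mem_univ, if_true]

theorem finite_strandSign_ne_zero (i : Fin D.n) (x : UnitAddCircle) :
    (Icc (0 : ℝ) 1 ∩
      Function.support fun t : ℝ => D.strandSign (i, x + (t : UnitAddCircle))).Finite := by
  have hpass (t : ℝ) : D.strandSign (i, x + (t : UnitAddCircle)) ≠ 0 →
      (i, x + (t : UnitAddCircle)) ∈ D.passages :=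
    not_imp_comm.1 D.strandSign_of_notMem
  have hIco : {t : ℝ | t ∈ Ico 0 1 ∧ (i, x + (t : UnitAddCircle)) ∈ D.passages}.Finite :=
    Finite.of_finite_image (D.passages_finite.subset (image_subset_iff.2 fun _ ht => ht.2))
      ((injOn_prodMk_add_coe i x).mono fun _ ht => ht.1)
  refine (hIco.insert 1).subset fun t ht => ?_
  rcases ht.1.2.eq_or_lt with rfl | hlt
  · exact mem_insert _ _
  · exact mem_insert_of_mem _ ⟨⟨ht.1.1, hlt⟩, hpass t ht.2⟩

theorem doubledIndex_sub_doubledIndex (i : Fin D.n) (x : UnitAddCircle) {L : ℝ} (hL : 0 < L)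
    (hL1 : L ≤ 1) :
    D.doubledIndex (D.pos (i, x + (L : UnitAddCircle))) - D.doubledIndex (D.pos (i, x)) =
      -D.strandSign (i, x) - D.strandSign (i, x + (L : UnitAddCircle)) -
        2 * ∑ᶠ t ∈ Ioo 0 L, D.strandSign (i, x + (t : UnitAddCircle)) := by
  have hjump (s : ℝ) : ∀ᶠ t : ℝ in 𝓝 s, D.doubledIndex (D.pos (i, x + (t : UnitAddCircle))) =
      D.doubledIndex (D.pos (i, x + (s : UnitAddCircle))) -
        SignType.sign (t - s) * D.strandSign (i, x + (s : UnitAddCircle)) := by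
    have hsub : Tendsto (fun t => t - s) (𝓝 s) (𝓝 0) := by
      simpa using (continuous_sub_right s).tendsto s
    filter_upwards [hsub.eventually
      (D.eventually_doubledIndex_eq (i, x + (s : UnitAddCircle)))] with t ht
    rwa [add_assoc, ← AddCircle.coe_add, add_sub_cancel] at ht
  have hzero : x + ((0 : ℝ) : UnitAddCircle) = x := add_zero x
  have h := sub_eq_of_jumps hL ((D.finite_strandSign_ne_zero i x).subset
    (inter_subset_inter_left _ (Icc_subset_Icc_right hL1))) fun s _ => hjump s
  rwa [hzero] at h

end GenericImmersion

namespace VirtualLinkDiagram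

variable (D : VirtualLinkDiagram)

theorem mem_passages_of_mem_classical {p : D.Point} (h : D.pos p ∈ D.classical) :
    p ∈ D.passages := by
  obtain ⟨q, hq, hqp⟩ := D.classical_subset h
  rcases eq_or_ne q p with rfl | hne
  · exact hq
  · exact ⟨q, hne, hqp⟩

theorem strandSign_initial (e : D.LongArc) :
    D.strandSign e.initial = 1 ∨ D.strandSign e.initial = -1 :=
  D.strandSign_eq_one_or (D.mem_passages_of_mem_classical e.start_mem)

theorem strandSign_terminal (e : D.LongArc) :
    D.strandSign e.terminal = 1 ∨ D.strandSign e.terminal = -1 :=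
  D.strandSign_eq_one_or (D.mem_passages_of_mem_classical e.stop_mem)

theorem pos_notMem_classical_of_mem_edgeInterior {e : D.Edge} {p : D.Point}
    (hp : p ∈ D.edgeInterior e) : D.pos p ∉ D.classical := by
  rcases e with e | i
  · obtain ⟨t, ht, rfl⟩ := hp
    exact e.interior_notMem t ht.1 ht.2
  · obtain ⟨j, y⟩ := p
    obtain rfl : j = i.1 := hp
    exact i.2 y

theorem virtualIndexCocycle_apply (e : D.Edge) :
    D.virtualIndexCocycle e = ∑ᶠ p ∈ D.edgeInterior e, D.strandSign p := by
  rw [virtualIndexCocycle, ← finsum_mem_eq_finite_toFinset_sum]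
  refine finsum_mem_inter_support_eq' _ _ _ fun p hp => and_iff_right_of_imp fun he =>
    ⟨not_imp_comm.1 D.strandSign_of_notMem hp, D.pos_notMem_classical_of_mem_edgeInterior he⟩

theorem virtualIndexCocycle_inl (e : D.LongArc) :
    D.virtualIndexCocycle (Sum.inl e) =
      ∑ᶠ t ∈ Ioo 0 e.length, D.strandSign (e.comp, e.start + (t : UnitAddCircle)) := by
  rw [virtualIndexCocycle_apply]
  exact finsum_mem_image ((injOn_prodMk_add_coe e.comp e.start).mono
    (Ioo_subset_Ico_self.trans (Ico_subset_Ico_right e.length_le)))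

theorem edgeInterior_inr (i : D.FreeCircle) :
    D.edgeInterior (Sum.inr i) =
      (fun t : ℝ => (i.1, 0 + (t : UnitAddCircle))) '' Ico 0 1 := by
  ext ⟨j, y⟩
  constructor
  · rintro rfl
    obtain ⟨t, ht, rfl⟩ : y ∈ ((↑) : ℝ → UnitAddCircle) '' Ico (0 : ℝ) (0 + 1) := by
      rw [AddCircle.coe_image_Ico_eq]
      exact mem_univ y
    exact ⟨t, by simpa only [zero_add] using ht, by simp only [zero_add]⟩
  · rintro ⟨t, -, h⟩
    exact (congrArg Prod.fst h).symm

theorem virtualIndexCocycle_inr (i : D.FreeCircle) : D.virtualIndexCocycle (Sum.inr i) = 0 := by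
  have hfin := (D.finite_strandSign_ne_zero i.1 0).subset
    (inter_subset_inter_left _ (Ioo_subset_Icc_self (a := (0 : ℝ))))
  have hsum : D.virtualIndexCocycle (Sum.inr i) = D.strandSign (i.1, 0) +
      ∑ᶠ t ∈ Ioo (0 : ℝ) 1, D.strandSign (i.1, 0 + (t : UnitAddCircle)) := by
    rw [virtualIndexCocycle_apply, edgeInterior_inr,
      finsum_mem_image (injOn_prodMk_add_coe i.1 0), ← Ioo_insert_left one_pos,
      finsum_mem_insert' _ left_notMem_Ioo hfin, QuotientAddGroup.mk_zero, add_zero]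
  have hperiod : (0 : UnitAddCircle) + ((1 : ℝ) : UnitAddCircle) = 0 := by
    rw [AddCircle.coe_period, add_zero]
  have h := D.doubledIndex_sub_doubledIndex i.1 0 one_pos le_rfl
  rw [hperiod] at h
  omega

open Classical in
theorem leftCanonicalCocycle_inl (e : D.LongArc) :
    D.leftCanonicalCocycle (Sum.inl e) = (if D.strandSign e.terminal = 1 then -1 else 0)
      + (if D.strandSign e.initial = -1 then 1 else 0) := by
  simp only [leftCanonicalCocycle, leftCochain, Finset.sum_apply, Sum.elim_inl,
    Finset.sum_add_distrib, ite_and, Finset.sum_ite_eq, Finset.mem_univ, if_true]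

open Classical in
theorem rightCanonicalCocycle_inl (e : D.LongArc) :
    D.rightCanonicalCocycle (Sum.inl e) = (if D.strandSign e.terminal = -1 then 1 else 0)
      + (if D.strandSign e.initial = 1 then -1 else 0) := by
  simp only [rightCanonicalCocycle, rightCochain, Finset.sum_apply, Sum.elim_inl,
    Finset.sum_add_distrib, ite_and, Finset.sum_ite_eq, Finset.mem_univ, if_true]

theorem two_mul_leftCanonicalCocycle_inl (e : D.LongArc) :
    2 * D.leftCanonicalCocycle (Sum.inl e) = -D.strandSign e.initial - D.strandSign e.terminal := by
  rw [leftCanonicalCocycle_inl]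
  rcases D.strandSign_initial e with h | h <;> rcases D.strandSign_terminal e with h' | h' <;>
    simp [h, h']

theorem two_mul_rightCanonicalCocycle_inl (e : D.LongArc) :
    2 * D.rightCanonicalCocycle (Sum.inl e) =
      -D.strandSign e.initial - D.strandSign e.terminal := by
  rw [rightCanonicalCocycle_inl]
  rcases D.strandSign_initial e with h | h <;> rcases D.strandSign_terminal e with h' | h' <;>
    simp [h, h']

theorem leftCanonicalCocycle_inr (i : D.FreeCircle) : D.leftCanonicalCocycle (Sum.inr i) = 0 := by
  simp [leftCanonicalCocycle, leftCochain]

theorem rightCanonicalCocycle_inr (i : D.FreeCircle) : D.rightCanonicalCocycle (Sum.inr i) = 0 := by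
  simp [rightCanonicalCocycle, rightCochain]

theorem leftCanonicalCocycle_eq_rightCanonicalCocycle :
    D.leftCanonicalCocycle = D.rightCanonicalCocycle := by
  funext e
  rcases e with e | i
  · exact mul_left_cancel₀ two_ne_zero ((D.two_mul_leftCanonicalCocycle_inl e).trans
      (D.two_mul_rightCanonicalCocycle_inl e).symm)
  · rw [leftCanonicalCocycle_inr, rightCanonicalCocycle_inr]

theorem doubledIndex_target_sub_doubledIndex_source (e : D.LongArc) :
    D.doubledIndex e.target - D.doubledIndex e.source =
      2 * (D.leftCanonicalCocycle (Sum.inl e) - D.virtualIndexCocycle (Sum.inl e)) := by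
  rw [mul_sub, two_mul_leftCanonicalCocycle_inl, virtualIndexCocycle_inl]
  exact D.doubledIndex_sub_doubledIndex e.comp e.start e.length_pos e.length_le

-- Along an arc `doubledIndex` changes by even numbers, so its half may be rounded.
theorem coboundary_doubledIndex_div_two :
    D.coboundary (fun c => D.doubledIndex c / 2) =
      D.leftCanonicalCocycle - D.virtualIndexCocycle := by
  funext e
  rcases e with e | i
  · have h := D.doubledIndex_target_sub_doubledIndex_source e
    change D.doubledIndex e.target / 2 - D.doubledIndex e.source / 2 =
      D.leftCanonicalCocycle (Sum.inl e) - D.virtualIndexCocycle (Sum.inl e)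
    omega
  · rw [Pi.sub_apply, leftCanonicalCocycle_inr, virtualIndexCocycle_inr, sub_zero]
    rfl

end VirtualLinkDiagram

/-- The canonical index cocycle (the common value of the left and the right one) is cohomologous to
the virtual index cocycle, that is, it represents the virtual index class. -/
theorem theorem1 (D : VirtualLinkDiagram) :
    D.leftCanonicalCocycle = D.rightCanonicalCocycle ∧
      D.Cohomologous D.leftCanonicalCocycle D.virtualIndexCocycle ∧
      D.cohomologyClass D.leftCanonicalCocycle = D.virtualIndexClass := by
  have h := D.coboundary_doubledIndex_div_two
  exact ⟨D.leftCanonicalCocycle_eq_rightCanonicalCocycle, ⟨_, h.symm⟩,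
    QuotientAddGroup.eq_iff_sub_mem.2 ⟨_, h⟩⟩
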